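/- **Theorem (Strong law of large numbers for incremental sums).** Let $(\Omega,\mathcal F,\mathbb P)$ be a probability space and let $\{X_k(m) : k\in\mathbb N,\ m>0\}$ be a family of integrable real random variables on it that is independent in $k$, i.e. for every choice of $t_1,t_2,\ldots>0$ the random variables $X_1(t_1),X_2(t_2),\ldots$ are mutually independent. Assume: * (C) (centering) $\mathbb E[X_k(m)]=0$ for all $k\in\mathbb N$ and $m>0$; * (S1) (polynomial decay) there is a $\delta>0$ such that for every $\varepsilon>0$ there is a constant $C=C(\varepsilon)$ with $$\sup_{k}\mathbb P\big(|X_k(m)|>\varepsilon\big)\le \frac{C}{m^{\delta}}\qquad\text{for all } m>0;$$ * (S2) (stochastic domination and moment control) there are a random variable $X_*$ on $\Omega$ and a $\gamma>0$ such that $\mathbb E\big[|X_*|^{2+\gamma}\big]<\infty$ and $$\sup_{k\in\mathbb N,\,m>0}\mathbb P\big(|X_k(m)|>x\big)\le \mathbb P\big(|X_*|>x\big)\qquad\text{for all } x\in\mathbb R.$$ Let $(m_k)_{k\in\mathbb N}$ be any sequence of masses $m_k\ge 0$ with $\sum_{k} m_k=\infty$. Put $M_n=\sum_{k=1}^n m_k$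 and $$S_n=\sum_{k=1}^n \frac{m_k}{M_n}\,X_k(m_k)$$ (terms with $m_k=0$ are zero; $M_n>0$ for all large $n$). Then $$\mathbb P\Big(\lim_{n\to\infty}S_n=0\Big)=1.$$ -/

import Mathlib

open MeasureTheory ProbabilityTheory Filter Topology

/-- The accumulated mass of the first `n` increments (increments are numbered from `0`). -/
noncomputable def totalMass (m : ℕ → ℝ) (n : ℕ) : ℝ :=
  ∑ k ∈ Finset.range n, m k

/-- The incremental sum of the first `n` increments: the average of the variables `X k (m k)`,
weighted by the masses `m k`. -/
noncomputable def incrementalSum {Ω : Type*} (X : ℕ → ℝ → Ω → ℝ) (m : ℕ → ℝ) (n : ℕ)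
    (ω : Ω) : ℝ :=
  ∑ k ∈ Finset.range n, m k / totalMass m n * X k (m k) ω

/-- `X k t`, for `k : ℕ` and `t > 0`, is a family of integrable random variables which is
independent in `k`: the variables `X k (t k)` are mutually independent for each choice of positive
parameters `t k`. (This holds in particular when the processes `(X k t)_{t > 0}` are
independent for different `k`.) Nothing is required at parameters `t ≤ 0`. -/
structure IsIndependentFamily {Ω : Type*} [MeasurableSpace Ω] (P : Measure Ω)
    (X : ℕ → ℝ → Ω → ℝ) : Prop where
  measurable : ∀ k t, 0 < t → Measurable (X k t)
  integrable : ∀ k t, 0 < t → Integrable (X k t) P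
  indep : ∀ t : ℕ → ℝ, (∀ k, 0 < t k) → iIndepFun (fun k => X k (t k)) P

/-- Centering: all the variables have mean zero. -/
def IsCentred {Ω : Type*} [MeasurableSpace Ω] (P : Measure Ω) (X : ℕ → ℝ → Ω → ℝ) : Prop :=
  ∀ k t, 0 < t → ∫ ω, X k t ω ∂P = 0

/-- Polynomial decay: concentration around zero at a polynomial rate in the parameter, uniformly
in the index. The exponent `δ` does not depend on `ε`, the constant `C` may. -/
def HasPolynomialDecay {Ω : Type*} [MeasurableSpace Ω] (P : Measure Ω)
    (X : ℕ → ℝ → Ω → ℝ) : Prop :=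
  ∃ δ : ℝ, 0 < δ ∧ ∀ ε : ℝ, 0 < ε → ∃ C : ℝ, ∀ t : ℝ, 0 < t → ∀ k : ℕ,
    P.real {ω | ε < |X k t ω|} ≤ C / t ^ δ

/-- Stochastic domination of all the variables, in absolute value, by a single random variable
with a finite absolute moment of some order larger than `2`. -/
def IsStochasticallyDominated {Ω : Type*} [MeasurableSpace Ω] (P : Measure Ω)
    (X : ℕ → ℝ → Ω → ℝ) : Prop :=
  ∃ (Xstar : Ω → ℝ) (γ : ℝ), Measurable Xstar ∧ 0 < γ ∧
    Integrable (fun ω => |Xstar ω| ^ (2 + γ)) P ∧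
    ∀ (x : ℝ) (k : ℕ) (t : ℝ), 0 < t → P {ω | x < |X k t ω|} ≤ P {ω | x < |Xstar ω|}

/-! Bounded variances alone do not suffice: for masses like 2^k the sum of (m_k / M_k)² diverges. So
each variable is cut at a small level ε. The parts below ε contribute at most ε to any weighted
average. By centering, the means of the parts above ε are also at most ε, so it remains to treat the
centred large parts.

Their second moments are O(t^(-η)) for some 0 < η < 1: up to a level K, (S1) bounds the probability
of being large; beyond K, the moment of order 2+γ takes over; K is a suitable power of t. Since m_k
≤ M_k, the normalised variances m_k² M_k^(-2) m_k^(-η) are at most m_k M_k^(-1-η), which is summable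
by comparison with the integral of x^(-1-η), however large the jumps. Kolmogorov's theorem and
Kronecker's lemma then send the averages of the centred large parts to 0. -/

/-! ### Convergence of random series and Kronecker's lemma -/

/-- **Kolmogorov's one-series theorem**: a series of independent centred square integrable random
variables with summable variances converges almost surely. -/
theorem ae_exists_tendsto_sum_of_summable_sq {Ω : Type*} [MeasurableSpace Ω] {P : Measure Ω}
    [IsProbabilityMeasure P] {W : ℕ → Ω → ℝ} (hind : iIndepFun W P)
    (hmeas : ∀ k, Measurable (W k)) (hL2 : ∀ k, MemLp (W k) 2 P)
    (hc : ∀ k, ∫ ω, W k ω ∂P = 0) (hsum : Summable fun k => ∫ ω, W k ω ^ 2 ∂P) :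
    ∀ᵐ ω ∂P, ∃ s, Tendsto (fun n => ∑ k ∈ Finset.range n, W k ω) atTop (𝓝 s) := by
  have hsm : ∀ k, StronglyMeasurable (W k) := fun k => (hmeas k).stronglyMeasurable
  have hint : ∀ k, Integrable (W k) P := fun k => (hL2 k).integrable one_le_two
  set 𝒢 := Filtration.natural W hsm
  set f : ℕ → Ω → ℝ := fun n => ∑ k ∈ Finset.range (n + 1), W k with hf
  have hadp : StronglyAdapted 𝒢 f := fun n =>
    Finset.stronglyMeasurable_sum _ fun i hi =>
      (Filtration.stronglyAdapted_natural hsm i).mono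
        (𝒢.mono (Nat.lt_succ_iff.mp (Finset.mem_range.mp hi)))
  have hfL2 : ∀ n, MemLp (f n) 2 P := fun n => memLp_finsetSum' _ fun i _ => hL2 i
  have hfint : ∀ n, Integrable (f n) P := fun n => (hfL2 n).integrable one_le_two
  have hmart : Martingale f 𝒢 P := by
    refine martingale_nat hadp hfint fun n => ?_
    have h1 : f (n + 1) = f n + W (n + 1) := by
      simp only [hf]
      rw [Finset.sum_range_succ _ (n + 1)]
    have h2 := hind.condExp_natural_ae_eq_of_lt hsm (Nat.lt_succ_self n)
    have h3 := condExp_add (hfint n) (hint (n + 1)) (𝒢 n)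
    rw [condExp_of_stronglyMeasurable (𝒢.le n) (hadp n) (hfint n)] at h3
    rw [h1]
    filter_upwards [h2, h3] with ω h2 h3
    rw [h3, Pi.add_apply, h2, hc, add_zero]
  have hsq : ∀ n, ∫ ω, f n ω ^ 2 ∂P ≤ ∑' k, ∫ ω, W k ω ^ 2 ∂P := by
    intro n
    have h0 : ∫ ω, f n ω ∂P = 0 := by
      simp only [hf, Finset.sum_apply]
      rw [integral_finsetSum _ fun i _ => hint i]
      simp [hc]
    have h1 := IndepFun.variance_sum (μ := P) (s := Finset.range (n + 1)) (fun i _ => hL2 i)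
      (fun i _ j _ hij => hind.indepFun hij)
    rw [variance_of_integral_eq_zero (hfL2 n).aestronglyMeasurable.aemeasurable h0] at h1
    rw [h1]
    have h2 : ∀ k, variance (W k) P = ∫ ω, W k ω ^ 2 ∂P := fun k =>
      variance_of_integral_eq_zero (hmeas k).aemeasurable (hc k)
    simp only [h2]
    exact hsum.sum_le_tsum _ fun i _ => integral_nonneg fun ω => sq_nonneg _
  -- Martingale convergence needs only an L¹ bound; |x| ≤ 1 + x² supplies it.
  have hbdd : ∀ n, eLpNorm (f n) 1 P ≤
      (1 + ∑' k, ∫ ω, W k ω ^ 2 ∂P).toNNReal := by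
    intro n
    rw [eLpNorm_one_eq_lintegral_enorm, ← ofReal_integral_norm_eq_lintegral_enorm (hfint n)]
    refine ENNReal.ofReal_le_ofReal ?_
    calc ∫ ω, ‖f n ω‖ ∂P ≤ ∫ ω, (1 + f n ω ^ 2) ∂P := by
          refine integral_mono (hfint n).norm
            ((integrable_const _).add (hfL2 n).integrable_sq) fun ω => ?_
          simp only [Real.norm_eq_abs]
          nlinarith [sq_abs (f n ω), sq_nonneg (|f n ω| - 1)]
      _ = 1 + ∫ ω, f n ω ^ 2 ∂P := by
          rw [integral_add (integrable_const _) (hfL2 n).integrable_sq]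
          simp
      _ ≤ _ := by linarith [hsq n]
  filter_upwards [hmart.submartingale.exists_ae_tendsto_of_bdd hbdd] with ω ⟨s, hs⟩
  refine ⟨s, (tendsto_add_atTop_iff_nat 1).mp ?_⟩
  simpa only [hf, Finset.sum_apply] using hs

/-- **Kronecker's lemma**. -/
theorem tendsto_sum_div_of_tendsto_sum {b x : ℕ → ℝ} {s : ℝ} (hb : Monotone b)
    (hbtop : Tendsto b atTop atTop)
    (hs : Tendsto (fun n => ∑ k ∈ Finset.range n, x k) atTop (𝓝 s)) :
    Tendsto (fun n => (∑ k ∈ Finset.range n, b (k + 1) * x k) / b n) atTop (𝓝 0) := by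
  set T : ℕ → ℝ := fun n => ∑ k ∈ Finset.range n, x k with hT
  -- Abel summation with the partial sums recentred at `s`: what remains is a Cesàro-type average of
  -- a null sequence.
  have habel : ∀ n, ∑ k ∈ Finset.range n, b (k + 1) * x k =
      b n * (T n - s) + b 0 * s - ∑ k ∈ Finset.range n, (b (k + 1) - b k) * (T k - s) := by
    intro n
    induction n with
    | zero => simp [hT]
    | succ n ih =>
      have hTn : T (n + 1) = T n + x n := Finset.sum_range_succ _ _
      rw [Finset.sum_range_succ, ih, Finset.sum_range_succ, hTn]
      ring
  have hTs : Tendsto (fun n => T n - s) atTop (𝓝 0) := by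
    simpa using hs.sub_const s
  have hlo : (fun n => ∑ k ∈ Finset.range n, (b (k + 1) - b k) * (T k - s)) =o[atTop]
      fun n => ∑ k ∈ Finset.range n, (b (k + 1) - b k) := by
    refine Asymptotics.IsLittleO.sum_range ?_ (fun n => sub_nonneg.mpr (hb n.le_succ)) ?_
    · simpa using (Asymptotics.isBigO_refl (fun n => b (n + 1) - b n) atTop).mul_isLittleO
        ((Asymptotics.isLittleO_one_iff ℝ).mpr hTs)
    · simp only [Finset.sum_range_sub]
      exact tendsto_atTop_add_const_right _ (-b 0) hbtop
  have hO : (fun n => ∑ k ∈ Finset.range n, (b (k + 1) - b k)) =O[atTop] b := by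
    simp only [Finset.sum_range_sub]
    exact (Asymptotics.isBigO_refl b atTop).sub
      (Asymptotics.isLittleO_const_left.mpr (Or.inr (tendsto_norm_atTop_atTop.comp hbtop))).isBigO
  have h1 := (hlo.trans_isBigO hO).tendsto_div_nhds_zero
  have h2 : Tendsto (fun n => b 0 * s / b n) atTop (𝓝 0) := hbtop.const_div_atTop _
  have h3 := (hTs.add h2).sub h1
  simp only [add_zero, sub_zero] at h3
  refine h3.congr' ?_
  filter_upwards [hbtop.eventually_gt_atTop 0] with n hn
  rw [habel]
  field_simp

/-! ### Summability along a growing sequence -/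

/-- The right side is the integral of x^(-1-η) over [a, b], the left its lower Riemann sum for one
interval. -/
theorem sub_mul_rpow_le {η a b : ℝ} (hη : 0 < η) (ha : 0 < a) (hab : a ≤ b) :
    (b - a) * b ^ (-(1 + η)) ≤ η⁻¹ * (a ^ (-η) - b ^ (-η)) := by
  have hb : 0 < b := ha.trans_le hab
  have hlog : Real.log (a / b) ≤ a / b - 1 := Real.log_le_sub_one_of_pos (div_pos ha hb)
  have hexp : 1 + η * (1 - a / b) ≤ (a / b) ^ (-η) := by
    rw [Real.rpow_def_of_pos (div_pos ha hb)]
    have := Real.add_one_le_exp (Real.log (a / b) * -η)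
    nlinarith
  rw [Real.div_rpow ha.le hb.le, le_div_iff₀ (Real.rpow_pos_of_pos hb _)] at hexp
  have hsplit : b ^ (-(1 + η)) = b⁻¹ * b ^ (-η) := by
    rw [neg_add, Real.rpow_add hb, Real.rpow_neg_one]
  rw [hsplit, ← div_eq_inv_mul (_ - _) η, le_div_iff₀ hη]
  have : (b - a) * (b⁻¹ * b ^ (-η)) * η = η * (1 - a / b) * b ^ (-η) := by
    field_simp
  rw [this]
  linarith

/-- The bounds telescope. Evaluating the power at the right endpoint is what allows arbitrary jumps.
-/
theorem summable_sub_mul_rpow {η : ℝ} {b : ℕ → ℝ} (hη : 0 < η) (hb : Monotone b)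
    (hpos : 0 < b 0) : Summable fun k => (b (k + 1) - b k) * b (k + 1) ^ (-(1 + η)) := by
  have hbpos : ∀ n, 0 < b n := fun n => hpos.trans_le (hb n.zero_le)
  refine summable_of_sum_range_le (c := η⁻¹ * b 0 ^ (-η))
    (fun k => mul_nonneg (sub_nonneg.mpr (hb k.le_succ)) (Real.rpow_nonneg (hbpos _).le _))
    fun n => ?_
  calc ∑ k ∈ Finset.range n, (b (k + 1) - b k) * b (k + 1) ^ (-(1 + η))
      ≤ ∑ k ∈ Finset.range n, η⁻¹ * (b k ^ (-η) - b (k + 1) ^ (-η)) :=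
        Finset.sum_le_sum fun k _ => sub_mul_rpow_le hη (hbpos k) (hb k.le_succ)
    _ = η⁻¹ * (b 0 ^ (-η) - b n ^ (-η)) := by
        rw [← Finset.mul_sum, Finset.sum_range_sub']
    _ ≤ η⁻¹ * b 0 ^ (-η) := by
        refine mul_le_mul_of_nonneg_left ?_ (inv_nonneg.mpr hη.le)
        linarith [Real.rpow_nonneg (hbpos n).le (-η)]

/-! ### Moments of the large parts -/

/-- Stochastic domination carries over to absolute moments. -/
theorem integrable_rpow_abs_of_dominated {Ω : Type*} [MeasurableSpace Ω] {P : Measure Ω}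
    {Y Z : Ω → ℝ} {p : ℝ} (hp : 0 < p) (hY : Measurable Y) (hZ : Measurable Z)
    (hZp : Integrable (fun ω => |Z ω| ^ p) P)
    (hdom : ∀ x, P {ω | x < |Y ω|} ≤ P {ω | x < |Z ω|}) :
    Integrable (fun ω => |Y ω| ^ p) P ∧ ∫ ω, |Y ω| ^ p ∂P ≤ ∫ ω, |Z ω| ^ p ∂P := by
  have hle : ∫⁻ ω, ENNReal.ofReal (|Y ω| ^ p) ∂P ≤ ∫⁻ ω, ENNReal.ofReal (|Z ω| ^ p) ∂P := by
    rw [lintegral_rpow_eq_lintegral_meas_lt_mul P (.of_forall fun ω => abs_nonneg (Y ω))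
        hY.abs.aemeasurable hp,
      lintegral_rpow_eq_lintegral_meas_lt_mul P (.of_forall fun ω => abs_nonneg (Z ω))
        hZ.abs.aemeasurable hp]
    exact mul_le_mul_right (lintegral_mono fun t => mul_le_mul_left (hdom t) _) _
  have hnn : ∀ f : Ω → ℝ, 0 ≤ᵐ[P] fun ω => |f ω| ^ p := fun f =>
    .of_forall fun ω => Real.rpow_nonneg (abs_nonneg _) _
  have hmY : AEStronglyMeasurable (fun ω => |Y ω| ^ p) P :=
    (hY.abs.pow_const p).aestronglyMeasurable
  have hfin : ∫⁻ ω, ENNReal.ofReal (|Z ω| ^ p) ∂P ≠ ⊤ := by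
    rw [← ofReal_integral_eq_lintegral_ofReal hZp (hnn Z)]
    exact ENNReal.ofReal_ne_top
  refine ⟨(lintegral_ofReal_ne_top_iff_integrable hmY (hnn Y)).mp (ne_top_of_le_ne_top hfin hle), ?_⟩
  rw [integral_eq_lintegral_of_nonneg_ae (hnn Y) hmY,
    integral_eq_lintegral_of_nonneg_ae (hnn Z) hZp.aestronglyMeasurable]
  exact ENNReal.toReal_mono hfin hle

/-- The part of a real number that exceeds the level `ε` in absolute value. -/
noncomputable def largePart (ε : ℝ) : ℝ → ℝ :=
  {x : ℝ | ε < |x|}.indicator id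

theorem measurable_largePart (ε : ℝ) : Measurable (largePart ε) :=
  measurable_id.indicator (measurableSet_lt measurable_const measurable_id.abs)

theorem abs_sub_largePart_le {ε : ℝ} (hε : 0 ≤ ε) (x : ℝ) : |x - largePart ε x| ≤ ε := by
  by_cases h : ε < |x|
  · simpa [largePart, h] using hε
  · simpa [largePart, Set.indicator, h] using not_lt.mp h

/-- For |x| ≤ K the square is at most K²; for |x| > K the factor (|x|/K)^γ exceeds 1. The level `K`
is free, to be optimised later. -/
theorem largePart_sq_le {ε γ K : ℝ} (hγ : 0 < γ) (hK : 0 < K) (x : ℝ) :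
    largePart ε x ^ 2 ≤ {x : ℝ | ε < |x|}.indicator (fun _ => K ^ 2) x +
      K ^ (-γ) * |x| ^ (2 + γ) := by
  by_cases h : ε < |x|
  · simp only [largePart, Set.indicator, Set.mem_ofPred_eq, h, if_true, id]
    have hr : 0 ≤ K ^ (-γ) * |x| ^ (2 + γ) := by positivity
    rcases le_or_gt |x| K with hxK | hxK
    · have : x ^ 2 ≤ K ^ 2 := by
        rw [← sq_abs x]
        exact pow_le_pow_left₀ (abs_nonneg x) hxK 2
      linarith
    · have hx : 0 < |x| := hK.trans hxK
      have h1 : 1 ≤ K ^ (-γ) * |x| ^ γ := by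
        rw [Real.rpow_neg hK.le, inv_mul_eq_div, one_le_div (Real.rpow_pos_of_pos hK _)]
        exact Real.rpow_le_rpow hK.le hxK.le hγ.le
      rw [Real.rpow_add hx, Real.rpow_two, sq_abs]
      nlinarith [sq_nonneg K, sq_nonneg x]
  · simp only [largePart, Set.indicator, Set.mem_ofPred_eq, h, if_false]
    have hr : 0 ≤ K ^ (-γ) * |x| ^ (2 + γ) := by positivity
    simpa using hr

/-- A random variable that is unlikely to exceed `ε` and has a moment of order larger than `2` has
a large part with small second moment. -/
theorem memLp_largePart {Ω : Type*} [MeasurableSpace Ω] {P : Measure Ω} [IsProbabilityMeasure P]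
    {Y : Ω → ℝ} {ε γ K : ℝ} (hγ : 0 < γ) (hK : 0 < K) (hY : Measurable Y)
    (hYp : Integrable (fun ω => |Y ω| ^ (2 + γ)) P) :
    MemLp (fun ω => largePart ε (Y ω)) 2 P ∧
      ∫ ω, largePart ε (Y ω) ^ 2 ∂P ≤
        K ^ 2 * P.real {ω | ε < |Y ω|} + K ^ (-γ) * ∫ ω, |Y ω| ^ (2 + γ) ∂P := by
  have hS : MeasurableSet {ω | ε < |Y ω|} := measurableSet_lt measurable_const hY.abs
  have hi1 : Integrable ({ω | ε < |Y ω|}.indicator fun _ => K ^ 2) P :=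
    (integrable_const _).indicator hS
  have hi := hi1.add (hYp.const_mul (K ^ (-γ)))
  have hle : ∀ ω, largePart ε (Y ω) ^ 2 ≤ {ω | ε < |Y ω|}.indicator (fun _ => K ^ 2) ω +
      K ^ (-γ) * |Y ω| ^ (2 + γ) := fun ω => largePart_sq_le hγ hK (Y ω)
  have hm : Measurable fun ω => largePart ε (Y ω) := (measurable_largePart ε).comp hY
  have hsq : Integrable (fun ω => largePart ε (Y ω) ^ 2) P :=
    hi.mono' (hm.pow_const 2).aestronglyMeasurable (.of_forall fun ω => by
      rw [Real.norm_of_nonneg (sq_nonneg _)]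
      exact hle ω)
  refine ⟨(memLp_two_iff_integrable_sq hm.aestronglyMeasurable).mpr hsq, ?_⟩
  refine (integral_mono hsq hi hle).trans_eq ?_
  simp only [Pi.add_apply]
  rw [integral_add hi1 (hYp.const_mul _), integral_indicator_const _ hS, integral_const_mul,
    smul_eq_mul, mul_comm (P.real _)]

/-- Uniformly in the index, the large parts have second moments of polynomial decay. -/
theorem exists_integral_largePart_sq_le {Ω : Type*} [MeasurableSpace Ω] {P : Measure Ω}
    [IsProbabilityMeasure P] {X : ℕ → ℝ → Ω → ℝ} (hX : IsIndependentFamily P X)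
    (hS1 : HasPolynomialDecay P X) (hS2 : IsStochasticallyDominated P X) {ε : ℝ} (hε : 0 < ε) :
    ∃ η D : ℝ, 0 < η ∧ η < 1 ∧ ∀ k t, 0 < t →
      MemLp (fun ω => largePart ε (X k t ω)) 2 P ∧
        ∫ ω, largePart ε (X k t ω) ^ 2 ∂P ≤ D * t ^ (-η) := by
  obtain ⟨δ₀, hδ₀, hdecay⟩ := hS1
  obtain ⟨C, hC⟩ := hdecay ε hε
  obtain ⟨Z, γ, hZ, hγ, hZp, hdom⟩ := hS2
  -- Capping the exponent at 1 forces η < 1. The decay survives: for t ≤ 1 the bound is trivial, for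
  -- t > 1 it only weakens.
  obtain ⟨δ, hδ, hδ1, hδle⟩ : ∃ δ : ℝ, 0 < δ ∧ δ ≤ 1 ∧ δ ≤ δ₀ :=
    ⟨min 1 δ₀, by positivity, min_le_left _ _, min_le_right _ _⟩
  have hprob : ∀ k t, 0 < t → P.real {ω | ε < |X k t ω|} ≤ max 1 C * t ^ (-δ) := by
    intro k t ht
    rcases le_or_gt t 1 with h1 | h1
    · calc P.real {ω | ε < |X k t ω|} ≤ 1 * 1 := by simp
        _ ≤ max 1 C * t ^ (-δ) := mul_le_mul (le_max_left _ _)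
            (Real.one_le_rpow_of_pos_of_le_one_of_nonpos ht h1 (by linarith)) zero_le_one
            (by positivity)
    · calc P.real {ω | ε < |X k t ω|} ≤ C / t ^ δ₀ := hC t ht k
        _ = C * t ^ (-δ₀) := by rw [Real.rpow_neg ht.le, div_eq_mul_inv]
        _ ≤ max 1 C * t ^ (-δ) := mul_le_mul (le_max_right _ _)
            (Real.rpow_le_rpow_of_exponent_le h1.le (by linarith)) (by positivity) (by positivity)
  have h2γ : 0 < 2 + γ := by linarith
  -- The choice K = t^(δ/(2+γ)) balances K² t^(-δ) against K^(-γ); both equal t^(-η).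
  refine ⟨γ * (δ / (2 + γ)), max 1 C + ∫ ω, |Z ω| ^ (2 + γ) ∂P, by positivity, ?_, ?_⟩
  · rw [← mul_div_assoc, div_lt_one h2γ]
    nlinarith
  intro k t ht
  obtain ⟨hint, hle⟩ := integrable_rpow_abs_of_dominated h2γ (hX.measurable k t ht) hZ hZp
    fun x => hdom x k t ht
  have hK : 0 < t ^ (δ / (2 + γ)) := Real.rpow_pos_of_pos ht _
  obtain ⟨hmem, hsq⟩ := memLp_largePart (ε := ε) hγ hK (hX.measurable k t ht) hint
  refine ⟨hmem, hsq.trans ?_⟩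
  have hK1 : (t ^ (δ / (2 + γ))) ^ (-γ) = t ^ (-(γ * (δ / (2 + γ)))) := by
    rw [← Real.rpow_mul ht.le]
    ring_nf
  have hK2 : (t ^ (δ / (2 + γ))) ^ 2 * t ^ (-δ) = t ^ (-(γ * (δ / (2 + γ)))) := by
    rw [← Real.rpow_natCast, ← Real.rpow_mul ht.le, ← Real.rpow_add ht]
    have h : δ / (2 + γ) * (2 + γ) = δ := div_mul_cancel₀ δ h2γ.ne'
    congr 1
    push_cast
    linarith
  rw [hK1, add_mul]
  refine add_le_add ?_ ?_
  · calc (t ^ (δ / (2 + γ))) ^ 2 * P.real {ω | ε < |X k t ω|}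
        ≤ (t ^ (δ / (2 + γ))) ^ 2 * (max 1 C * t ^ (-δ)) :=
          mul_le_mul_of_nonneg_left (hprob k t ht) (sq_nonneg _)
      _ = max 1 C * ((t ^ (δ / (2 + γ))) ^ 2 * t ^ (-δ)) := by ring
      _ = _ := by rw [hK2]
  · rw [mul_comm]
    exact mul_le_mul_of_nonneg_right hle (by positivity)

/-! ### Weighted averages and the strong law -/

theorem totalMass_succ (m : ℕ → ℝ) (n : ℕ) : totalMass m (n + 1) = totalMass m n + m n :=
  Finset.sum_range_succ _ _

theorem monotone_totalMass {m : ℕ → ℝ} (hm : ∀ k, 0 ≤ m k) : Monotone (totalMass m) :=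
  monotone_nat_of_le_succ fun n => by linarith [totalMass_succ m n, hm n]

theorem totalMass_nonneg {m : ℕ → ℝ} (hm : ∀ k, 0 ≤ m k) (n : ℕ) : 0 ≤ totalMass m n :=
  Finset.sum_nonneg fun k _ => hm k

/-- A strong law for weighted averages of independent centred variables, whose second moments
decay polynomially in the weights. -/
theorem ae_tendsto_weighted_average {Ω : Type*} [MeasurableSpace Ω] {P : Measure Ω}
    [IsProbabilityMeasure P] {V : ℕ → Ω → ℝ} {m : ℕ → ℝ} {η D : ℝ} (hm : ∀ k, 0 ≤ m k)
    (hdiv : Tendsto (totalMass m) atTop atTop) (hind : iIndepFun V P)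
    (hmeas : ∀ k, Measurable (V k)) (hL2 : ∀ k, MemLp (V k) 2 P)
    (hc : ∀ k, ∫ ω, V k ω ∂P = 0) (hη : 0 < η) (hη1 : η < 1)
    (hV : ∀ k, 0 < m k → ∫ ω, V k ω ^ 2 ∂P ≤ D * m k ^ (-η)) :
    ∀ᵐ ω ∂P, Tendsto (fun n => (∑ k ∈ Finset.range n, m k * V k ω) / totalMass m n)
      atTop (𝓝 0) := by
  -- The shift by 1 keeps the normaliser positive even if the first masses vanish; `hratio` undoes
  -- it in the limit.
  set b : ℕ → ℝ := fun n => 1 + totalMass m n with hb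
  have hbpos : ∀ n, 0 < b n := fun n => by linarith [totalMass_nonneg hm n]
  have hbmono : Monotone b := (monotone_totalMass hm).const_add 1
  have hbtop : Tendsto b atTop atTop := tendsto_atTop_add_const_left _ 1 hdiv
  have hbm : ∀ k, b (k + 1) - b k = m k := fun k => by
    simp only [hb, totalMass_succ]
    ring
  set W : ℕ → Ω → ℝ := fun k ω => m k / b (k + 1) * V k ω with hW
  have hWsq : ∀ k, ∫ ω, W k ω ^ 2 ∂P = (m k / b (k + 1)) ^ 2 * ∫ ω, V k ω ^ 2 ∂P := fun k => by
    simp only [hW, mul_pow]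
    rw [integral_const_mul]
  have hsum : Summable fun k => ∫ ω, W k ω ^ 2 ∂P := by
    refine Summable.of_nonneg_of_le (fun k => integral_nonneg fun ω => sq_nonneg _) (fun k => ?_)
      ((summable_sub_mul_rpow hη hbmono (hbpos 0)).mul_left (max D 0))
    rw [hWsq, hbm]
    rcases (hm k).eq_or_lt with h0 | h0
    · simp [← h0]
    have hmb : m k ≤ b (k + 1) := by linarith [hbm k, hbpos k]
    have hbk := hbpos (k + 1)
    have hD : D * m k ^ (-η) ≤ max D 0 * m k ^ (-η) :=
      mul_le_mul_of_nonneg_right (le_max_left _ _) (by positivity)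
    calc (m k / b (k + 1)) ^ 2 * ∫ ω, V k ω ^ 2 ∂P
        ≤ (m k / b (k + 1)) ^ 2 * (max D 0 * m k ^ (-η)) :=
          mul_le_mul_of_nonneg_left ((hV k h0).trans hD) (sq_nonneg _)
      _ = max D 0 * (m k * m k ^ (1 - η) / b (k + 1) ^ 2) := by
          rw [sub_eq_add_neg, Real.rpow_add h0, Real.rpow_one]
          ring_nf
      -- Here η < 1 matters: a nonnegative exponent lets `m k ≤ b (k + 1)` be used.
      _ ≤ max D 0 * (m k * b (k + 1) ^ (1 - η) / b (k + 1) ^ 2) := by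
          have := Real.rpow_le_rpow h0.le hmb (by linarith : 0 ≤ 1 - η)
          gcongr
      _ = max D 0 * (m k * b (k + 1) ^ (-(1 + η))) := by
          rw [mul_div_assoc, ← Real.rpow_two, ← Real.rpow_sub hbk]
          ring_nf
  have hconv := ae_exists_tendsto_sum_of_summable_sq (W := W)
    (hind.comp (fun k x => m k / b (k + 1) * x) fun k => measurable_const_mul _)
    (fun k => (hmeas k).const_mul _) (fun k => (hL2 k).const_mul _)
    (fun k => by simp only [hW, integral_const_mul, hc, mul_zero]) hsum
  have hratio : Tendsto (fun n => b n / totalMass m n) atTop (𝓝 1) := by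
    have h := (hdiv.const_div_atTop 1).add_const 1
    rw [zero_add] at h
    refine h.congr' ?_
    filter_upwards [hdiv.eventually_gt_atTop 0] with n hn
    simp only [hb]
    rw [add_div, div_self hn.ne']
  filter_upwards [hconv] with ω ⟨s, hs⟩
  have h := (tendsto_sum_div_of_tendsto_sum hbmono hbtop hs).mul hratio
  rw [zero_mul] at h
  refine h.congr fun n => ?_
  have hterm : ∀ k, b (k + 1) * W k ω = m k * V k ω := fun k => by
    have := (hbpos (k + 1)).ne'
    simp only [hW]
    field_simp
  simp only [hterm]
  rw [div_mul_div_cancel₀ (hbpos n).ne']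

/-- One ε each comes from the small parts, the means of the large parts, and the eventually small
average of the centred large parts. -/
theorem ae_eventually_abs_incrementalSum_le {Ω : Type*} [MeasurableSpace Ω] {P : Measure Ω}
    [IsProbabilityMeasure P] {X : ℕ → ℝ → Ω → ℝ} (hX : IsIndependentFamily P X)
    (hC : IsCentred P X) (hS1 : HasPolynomialDecay P X) (hS2 : IsStochasticallyDominated P X)
    {m : ℕ → ℝ} (hm : ∀ k, 0 ≤ m k) (hdiv : Tendsto (totalMass m) atTop atTop) {ε : ℝ}
    (hε : 0 < ε) : ∀ᵐ ω ∂P, ∀ᶠ n in atTop, |incrementalSum X m n ω| ≤ 3 * ε := by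
  obtain ⟨η, D, hη, hη1, hD⟩ := exists_integral_largePart_sq_le hX hS1 hS2 hε
  -- Nothing is known at parameter 0, so vanishing masses are replaced by 1 there; their weight
  -- remains 0.
  obtain ⟨t, ht, htm⟩ : ∃ t : ℕ → ℝ, (∀ k, 0 < t k) ∧ ∀ k, 0 < m k → t k = m k := by
    refine ⟨fun k => if 0 < m k then m k else 1, fun k => ?_, fun k hk => if_pos hk⟩
    dsimp only
    split_ifs with h
    exacts [h, one_pos]
  set Y : ℕ → Ω → ℝ := fun k ω => largePart ε (X k (t k) ω) with hY
  have hYL2 : ∀ k, MemLp (Y k) 2 P := fun k => (hD k (t k) (ht k)).1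
  have hYint : ∀ k, Integrable (Y k) P := fun k => (hYL2 k).integrable one_le_two
  have hYmeas : ∀ k, Measurable (Y k) := fun k =>
    (measurable_largePart ε).comp (hX.measurable k _ (ht k))
  have hmean : ∀ k, |∫ ω, Y k ω ∂P| ≤ ε := by
    intro k
    have h0 := hC k (t k) (ht k)
    have h1 : ∫ ω, (X k (t k) ω - Y k ω) ∂P = -∫ ω, Y k ω ∂P := by
      rw [integral_sub (hX.integrable k _ (ht k)) (hYint k), h0, zero_sub]
    rw [← abs_neg, ← h1, ← Real.norm_eq_abs]
    have hbound : ∀ᵐ ω ∂P, ‖X k (t k) ω - Y k ω‖ ≤ ε :=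
      .of_forall fun ω => abs_sub_largePart_le hε.le (X k (t k) ω)
    simpa using norm_integral_le_of_norm_le_const hbound
  set V : ℕ → Ω → ℝ := fun k ω => Y k ω - ∫ ω', Y k ω' ∂P with hV
  have hVsq : ∀ k, 0 < m k → ∫ ω, V k ω ^ 2 ∂P ≤ D * m k ^ (-η) := by
    intro k hk
    have h := (hD k (t k) (ht k)).2
    rw [htm k hk] at h
    refine le_trans ?_ h
    rw [← htm k hk, ← variance_eq_integral (hYmeas k).aemeasurable]
    exact variance_le_expectation_sq (hYmeas k).aestronglyMeasurable
  have hlim := ae_tendsto_weighted_average (V := V) hm hdiv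
    ((hX.indep t ht).comp (fun k x => largePart ε x - ∫ ω', Y k ω' ∂P)
      fun k => (measurable_largePart ε).sub_const _)
    (fun k => (hYmeas k).sub_const _) (fun k => (hYL2 k).sub (memLp_const _))
    (fun k => by
      simp only [hV]
      rw [integral_sub (hYint k) (integrable_const _)]
      simp) hη hη1 hVsq
  filter_upwards [hlim] with ω hω
  filter_upwards [hdiv.eventually_gt_atTop 0,
    hω.eventually (Metric.closedBall_mem_nhds 0 hε)] with n hn hclose
  rw [dist_zero_right, Real.norm_eq_abs] at hclose
  have hsplit : incrementalSum X m n ω = (∑ k ∈ Finset.range n, m k * V k ω) / totalMass m n +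
      (∑ k ∈ Finset.range n, m k * (X k (m k) ω - V k ω)) / totalMass m n := by
    rw [← add_div, ← Finset.sum_add_distrib, Finset.sum_div, incrementalSum]
    refine Finset.sum_congr rfl fun k _ => ?_
    ring
  have hrest : |(∑ k ∈ Finset.range n, m k * (X k (m k) ω - V k ω)) / totalMass m n| ≤ 2 * ε := by
    rw [abs_div, abs_of_pos hn, div_le_iff₀ hn, totalMass, Finset.mul_sum]
    refine (Finset.abs_sum_le_sum_abs _ _).trans (Finset.sum_le_sum fun k _ => ?_)
    rcases (hm k).eq_or_lt with h0 | h0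
    · simp [← h0]
    rw [abs_mul, abs_of_pos h0, mul_comm]
    refine mul_le_mul_of_nonneg_right ?_ h0.le
    have h1 := abs_le.mp (abs_sub_largePart_le hε.le (X k (t k) ω))
    have h2 := abs_le.mp (hmean k)
    rw [← htm k h0]
    simp only [hV, hY] at h1 h2 ⊢
    rw [abs_le]
    constructor <;> linarith [h1.1, h1.2, h2.1, h2.2]
  rw [hsplit]
  linarith [abs_add_le ((∑ k ∈ Finset.range n, m k * V k ω) / totalMass m n)
    ((∑ k ∈ Finset.range n, m k * (X k (m k) ω - V k ω)) / totalMass m n)]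

theorem theorem2p2 {Ω : Type*} [MeasurableSpace Ω] (P : Measure Ω) [IsProbabilityMeasure P]
    (X : ℕ → ℝ → Ω → ℝ) (hX : IsIndependentFamily P X)
    (hC : IsCentred P X) (hS1 : HasPolynomialDecay P X) (hS2 : IsStochasticallyDominated P X)
    (m : ℕ → ℝ) (hm : ∀ k, 0 ≤ m k) (hdiv : Tendsto (totalMass m) atTop atTop) :
    ∀ᵐ ω ∂P, Tendsto (fun n => incrementalSum X m n ω) atTop (𝓝 0) := by
  -- The exceptional null set depends on ε, so only countably many levels are used.
  have h : ∀ᵐ ω ∂P, ∀ j : ℕ, ∀ᶠ n in atTop, |incrementalSum X m n ω| ≤ 3 * (1 / ((j : ℝ) + 1)) :=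
    ae_all_iff.mpr fun j =>
      ae_eventually_abs_incrementalSum_le hX hC hS1 hS2 hm hdiv Nat.one_div_pos_of_nat
  filter_upwards [h] with ω hω
  refine Metric.tendsto_nhds.mpr fun r hr => ?_
  obtain ⟨j, hj⟩ := exists_nat_one_div_lt (show 0 < r / 3 by positivity)
  filter_upwards [hω j] with n hn
  rw [dist_zero_right, Real.norm_eq_abs]
  linarith
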